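/- Let $S^1=\mathbb{R}/2\pi\mathbb{Z}$, and for a distribution $u$ on $S^1$ let $\hat u(n)=(2\pi)^{-1}u(e^{-inx})$, $n\in\mathbb{Z}$. For $s\in\mathbb{R}$ let $H^s(S^1)$ be the complex Sobolev space of distributions $u$ with $\sum_{n}(1+n^2)^{s}|\hat u(n)|^2<\infty$. Let $(h_n)_{n\ge1},(l_n)_{n\ge1}$ be a family of independent standard real Gaussian variables on a probability space $(\Omega,\mathcal{A},p)$, put $g_n=\frac{1}{\sqrt2}(h_n-il_n)$ and $g_{-n}=\overline{g_n}$ for $n\ge1$, and let $$\varphi(\omega,x)=\sum_{n\neq0}\frac{g_n(\omega)}{2\sqrt{\pi|n|}}\,e^{inx}.$$ For a real valued zero mean distribution $u\in H^{r}(S^1)$, $-\tfrac12<r<0$, Tao's gauge transform is $$\Phi(u)=P_+\big(e^{-i\partial_x^{-1}u}\,u\big),$$ where $\partial_x^{-1}u=\sum_{n\neq0}\frac{\hat u(n)}{in}e^{inx}$ (a continuous function), $P_+$ is the projector on the frequencies $n>0$, and the product of $f=e^{-i\partial_x^{-1}u}\in H^{-r}(S^1)$ with $u\in H^{r}(S^1)$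 is the distribution with Fourier coefficients $\sum_m\hat f(m)\hat u(n-m)$. Let $s<0$. Then for almost every $\omega$ the following holds: $\varphi(\omega,\cdot)$ is a distribution on $S^1$ whose Fourier coefficients are those of the above series; $\Phi(\varphi(\omega,\cdot))$ is well defined, that is, for some $r\in(-\frac12,0)$, $\varphi(\omega,\cdot)$ is a real valued zero mean element of $H^{r}(S^1)$, the Fourier series of $\partial_x^{-1}\varphi(\omega,\cdot)$ converges absolutely, and $e^{-i\partial_x^{-1}\varphi(\omega,\cdot)}\in H^{-r}(S^1)$; and $\Phi(\varphi(\omega,\cdot))$ is a (complex valued) element of $H^s(S^1)$ with zero mean. -/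

import Mathlib

open MeasureTheory ProbabilityTheory

namespace BenjaminOno

section Deterministic

open scoped ContDiff

/-- Test functions on the circle `ℝ / 2πℤ`: smooth complex valued `2π`-periodic functions. -/
def TestFunction : Submodule ℂ (ℝ → ℂ) where
  carrier := {ψ | ContDiff ℝ ∞ ψ ∧ Function.Periodic ψ (2 * Real.pi)}
  add_mem' := fun ha hb => ⟨ha.1.add hb.1, ha.2.add hb.2⟩
  zero_mem' := ⟨contDiff_const, fun _ => rfl⟩
  smul_mem' := fun c _ hf => ⟨hf.1.const_smul c, hf.2.smul c⟩

/-- The exponential `x ↦ e^{inx}`. -/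
noncomputable def expFun (n : ℤ) (x : ℝ) : ℂ := Complex.exp (Complex.I * n * x)

theorem expFun_contDiff (n : ℤ) : ContDiff ℝ ∞ (expFun n) := by
  unfold expFun
  exact (contDiff_const.mul Complex.ofRealCLM.contDiff).cexp

theorem expFun_periodic (n : ℤ) : Function.Periodic (expFun n) (2 * Real.pi) := by
  intro x
  unfold expFun
  rw [Complex.exp_eq_exp_iff_exists_int]
  exact ⟨n, by push_cast; ring⟩

theorem expFun_norm (n : ℤ) (x : ℝ) : ‖expFun n x‖ = 1 := by
  unfold expFun
  rw [show Complex.I * n * x = ((n * x : ℝ) : ℂ) * Complex.I by push_cast; ring]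
  exact Complex.norm_exp_ofReal_mul_I _

theorem expFun_hasDerivAt (n : ℤ) (x : ℝ) :
    HasDerivAt (expFun n) (Complex.I * n * expFun n x) x := by
  have h : HasDerivAt (fun y : ℝ => Complex.I * n * (y : ℂ)) (Complex.I * n) x := by
    simpa using (Complex.ofRealCLM.hasDerivAt (x := x)).const_mul (Complex.I * n)
  exact h.cexp.congr_deriv (mul_comm _ _)

/-- `e^{inx}` as a test function. -/
noncomputable def expTest (n : ℤ) : TestFunction := ⟨expFun n, expFun_contDiff n, expFun_periodic n⟩

/-- A distribution on the circle: a linear functional on test functions that is continuous for the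
`C^∞` topology, that is, bounded by the sup norms of finitely many derivatives. -/
structure Distribution where
  toLin : TestFunction →ₗ[ℂ] ℂ
  bound : ∃ (C : ℝ) (k : ℕ), ∀ (ψ : TestFunction) (M : ℝ),
    (∀ j ≤ k, ∀ x : ℝ, ‖iteratedDeriv j (ψ : ℝ → ℂ) x‖ ≤ M) → ‖toLin ψ‖ ≤ C * M

/-- The Fourier coefficient `û(n) = (2π)⁻¹ u(e^{-inx})`. -/
noncomputable def Distribution.coeff (u : Distribution) (n : ℤ) : ℂ :=
  (2 * Real.pi : ℂ)⁻¹ * u.toLin (expTest (-n))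

/-- The distribution `ψ ↦ 0`. -/
def zeroDistribution : Distribution := ⟨0, 0, 0, fun _ _ _ => by simp⟩

theorem testFunction_intervalIntegrable_mul {f : ℝ → ℂ}
    (hf : IntervalIntegrable f volume 0 (2 * Real.pi)) (ψ : TestFunction) :
    IntervalIntegrable (fun x => f x * (ψ : ℝ → ℂ) x) volume 0 (2 * Real.pi) :=
  hf.mul_continuousOn ψ.2.1.continuous.continuousOn

open Classical in
/-- The distribution `ψ ↦ ∫_{S¹} f ψ` induced by an integrable function `f` on the circle
(given on `[0, 2π]`); the zero distribution if `f` is not integrable. -/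
noncomputable def ofFunction (f : ℝ → ℂ) : Distribution :=
  if hf : IntervalIntegrable f volume 0 (2 * Real.pi) then
    { toLin :=
        { toFun := fun ψ => ∫ x in (0 : ℝ)..(2 * Real.pi), f x * (ψ : ℝ → ℂ) x
          map_add' := fun ψ χ => by
            rw [← intervalIntegral.integral_add (testFunction_intervalIntegrable_mul hf ψ)
              (testFunction_intervalIntegrable_mul hf χ)]
            simp [mul_add]
          map_smul' := fun c ψ => by
            rw [RingHom.id_apply, smul_eq_mul, ← intervalIntegral.integral_const_mul]
            congr 1
            ext x
            simp only [SetLike.val_smul, Pi.smul_apply, smul_eq_mul]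
            ring }
      bound := by
        refine ⟨∫ x in (0 : ℝ)..(2 * Real.pi), ‖f x‖, 0, fun ψ M hM => ?_⟩
        have hpi : (0 : ℝ) ≤ 2 * Real.pi := by positivity
        change ‖∫ x in (0 : ℝ)..(2 * Real.pi), f x * (ψ : ℝ → ℂ) x‖ ≤ _
        rw [← intervalIntegral.integral_mul_const]
        refine intervalIntegral.norm_integral_le_of_norm_le hpi ?_ (hf.norm.mul_const M)
        refine Filter.Eventually.of_forall fun x _ => ?_
        rw [norm_mul]
        have := hM 0 le_rfl x
        rw [iteratedDeriv_zero] at this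
        gcongr }
  else zeroDistribution

/-- Sequences of polynomial growth: the sequences of Fourier coefficients of distributions. -/
def PolyGrowth (c : ℤ → ℂ) : Prop :=
  ∃ (C : ℝ) (k : ℕ), ∀ n : ℤ, ‖c n‖ ≤ C * (1 + |(n : ℝ)|) ^ k

theorem integral_iteratedDeriv_mul_expFun (n : ℤ) (k : ℕ) (ψ : ℝ → ℂ) (hψ : ContDiff ℝ ∞ ψ)
    (hp : Function.Periodic ψ (2 * Real.pi)) :
    ∫ x in (0 : ℝ)..(2 * Real.pi), iteratedDeriv k ψ x * expFun n x =
      (-(Complex.I * n)) ^ k * ∫ x in (0 : ℝ)..(2 * Real.pi), ψ x * expFun n x := by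
  induction k generalizing ψ with
  | zero => simp
  | succ k ih =>
    have hd : ContDiff ℝ ∞ (deriv ψ) := ((contDiff_infty_iff_deriv).1 hψ).2
    have hdp : Function.Periodic (deriv ψ) (2 * Real.pi) := by
      intro x
      rw [← deriv_comp_add_const, show (fun y => ψ (y + 2 * Real.pi)) = ψ from funext hp]
    have hibp := intervalIntegral.integral_deriv_mul_eq_sub
      (a := 0) (b := 2 * Real.pi) (u := ψ) (v := expFun n) (u' := deriv ψ)
      (v' := fun x => Complex.I * n * expFun n x)
      (fun x _ => ((hψ.differentiable (by simp)) x).hasDerivAt)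
      (fun x _ => expFun_hasDerivAt n x)
      (hd.continuous.intervalIntegrable _ _)
      ((continuous_const.mul (expFun_contDiff n).continuous).intervalIntegrable _ _)
    have h1 : ψ (2 * Real.pi) = ψ 0 := by simpa using hp 0
    have h2 : expFun n (2 * Real.pi) = expFun n 0 := by simpa using expFun_periodic n 0
    rw [h1, h2, sub_self, intervalIntegral.integral_add
      (f := fun x => deriv ψ x * expFun n x) (g := fun x => ψ x * (Complex.I * n * expFun n x))
      ((hd.continuous.mul (expFun_contDiff n).continuous).intervalIntegrable _ _)
      ((hψ.continuous.mul
        (continuous_const.mul (expFun_contDiff n).continuous)).intervalIntegrable _ _)] at hibp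
    have h3 : ∫ x in (0 : ℝ)..(2 * Real.pi), ψ x * (Complex.I * n * expFun n x) =
        Complex.I * n * ∫ x in (0 : ℝ)..(2 * Real.pi), ψ x * expFun n x := by
      rw [← intervalIntegral.integral_const_mul]
      congr 1
      ext x
      ring
    rw [h3] at hibp
    rw [iteratedDeriv_succ', ih _ hd hdp, eq_neg_of_add_eq_zero_left hibp]
    ring

theorem norm_integral_mul_expFun_le (K : ℕ) (ψ : TestFunction) (M : ℝ)
    (hM : ∀ j ≤ K, ∀ x : ℝ, ‖iteratedDeriv j (ψ : ℝ → ℂ) x‖ ≤ M) (n : ℤ) :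
    ‖∫ x in (0 : ℝ)..(2 * Real.pi), (ψ : ℝ → ℂ) x * expFun n x‖ * (1 + |(n : ℝ)|) ^ K ≤
      2 ^ K * (4 * Real.pi) * M := by
  set J := ∫ x in (0 : ℝ)..(2 * Real.pi), (ψ : ℝ → ℂ) x * expFun n x with hJ
  have key : ∀ j ≤ K, |(n : ℝ)| ^ j * ‖J‖ ≤ M * (2 * Real.pi) := by
    intro j hj
    have h := integral_iteratedDeriv_mul_expFun n j ψ ψ.2.1 ψ.2.2
    have h' : ‖∫ x in (0 : ℝ)..(2 * Real.pi), iteratedDeriv j (ψ : ℝ → ℂ) x * expFun n x‖ ≤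
        M * |2 * Real.pi - 0| := by
      refine intervalIntegral.norm_integral_le_of_norm_le_const fun x _ => ?_
      rw [norm_mul, expFun_norm, mul_one]
      exact hM j hj x
    rw [h, ← hJ, norm_mul, norm_pow, norm_neg, norm_mul, Complex.norm_I, one_mul,
      Complex.norm_intCast, sub_zero, abs_of_pos Real.two_pi_pos] at h'
    exact h'
  have h0 := key 0 (Nat.zero_le _)
  have hK := key K le_rfl
  have hpow : (1 + |(n : ℝ)|) ^ K ≤ 2 ^ K * (1 + |(n : ℝ)| ^ K) := by
    rcases le_total |(n : ℝ)| 1 with h | h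
    · calc (1 + |(n : ℝ)|) ^ K ≤ 2 ^ K := by gcongr; linarith
        _ ≤ 2 ^ K * (1 + |(n : ℝ)| ^ K) :=
          le_mul_of_one_le_right (by positivity) (by linarith [pow_nonneg (abs_nonneg (n : ℝ)) K])
    · calc (1 + |(n : ℝ)|) ^ K ≤ (2 * |(n : ℝ)|) ^ K := by gcongr; linarith
        _ = 2 ^ K * |(n : ℝ)| ^ K := mul_pow _ _ _
        _ ≤ 2 ^ K * (1 + |(n : ℝ)| ^ K) := by gcongr; linarith
  calc ‖J‖ * (1 + |(n : ℝ)|) ^ K ≤ ‖J‖ * (2 ^ K * (1 + |(n : ℝ)| ^ K)) := by gcongr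
    _ = 2 ^ K * (|(n : ℝ)| ^ 0 * ‖J‖ + |(n : ℝ)| ^ K * ‖J‖) := by ring
    _ ≤ 2 ^ K * (M * (2 * Real.pi) + M * (2 * Real.pi)) := by gcongr
    _ = _ := by ring

theorem summable_one_add_abs_sq : Summable fun n : ℤ => ((1 + |(n : ℝ)|) ^ 2)⁻¹ := by
  have h : Summable fun n : ℤ => 1 / (n : ℝ) ^ 2 := Real.summable_one_div_int_pow.2 one_lt_two
  refine h.of_norm_bounded_eventually ?_
  have : ∀ᶠ n : ℤ in Filter.cofinite, n ≠ 0 := (Set.finite_singleton (0 : ℤ)).compl_mem_cofinite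
  filter_upwards [this] with n hn
  have hn' : (0 : ℝ) < |(n : ℝ)| := by positivity
  rw [Real.norm_of_nonneg (by positivity), one_div, ← sq_abs (n : ℝ)]
  gcongr
  linarith

theorem norm_coeff_mul_integral_le {c : ℤ → ℂ} {C : ℝ} {k : ℕ}
    (hc : ∀ n : ℤ, ‖c n‖ ≤ C * (1 + |(n : ℝ)|) ^ k) (ψ : TestFunction) (M : ℝ)
    (hM : ∀ j ≤ k + 2, ∀ x : ℝ, ‖iteratedDeriv j (ψ : ℝ → ℂ) x‖ ≤ M) (n : ℤ) :
    ‖c n * ∫ x in (0 : ℝ)..(2 * Real.pi), (ψ : ℝ → ℂ) x * expFun n x‖ ≤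
      C * (2 ^ (k + 2) * (4 * Real.pi) * M) * ((1 + |(n : ℝ)|) ^ 2)⁻¹ := by
  have h := norm_integral_mul_expFun_le (k + 2) ψ M hM n
  have hC : 0 ≤ C := by
    have := (norm_nonneg _).trans (hc 0)
    simpa using this
  have hpos : (0 : ℝ) < (1 + |(n : ℝ)|) ^ 2 := by positivity
  rw [norm_mul, ← div_eq_mul_inv, le_div_iff₀ hpos]
  set J := ‖∫ x in (0 : ℝ)..(2 * Real.pi), (ψ : ℝ → ℂ) x * expFun n x‖
  calc ‖c n‖ * J * (1 + |(n : ℝ)|) ^ 2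
      ≤ C * (1 + |(n : ℝ)|) ^ k * J * (1 + |(n : ℝ)|) ^ 2 := by gcongr; exact hc n
    _ = C * (J * (1 + |(n : ℝ)|) ^ (k + 2)) := by ring
    _ ≤ _ := by gcongr

theorem testFunction_bounded (K : ℕ) (ψ : TestFunction) :
    ∃ M : ℝ, ∀ j ≤ K, ∀ x : ℝ, ‖iteratedDeriv j (ψ : ℝ → ℂ) x‖ ≤ M := by
  have h1 : ∀ j : ℕ, ∃ B : ℝ, ∀ x : ℝ, ‖iteratedDeriv j (ψ : ℝ → ℂ) x‖ ≤ B := by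
    intro j
    have hcont : Continuous (iteratedDeriv j (ψ : ℝ → ℂ)) :=
      ψ.2.1.continuous_iteratedDeriv j (by exact_mod_cast le_top)
    have hper : Function.Periodic (iteratedDeriv j (ψ : ℝ → ℂ)) (2 * Real.pi) := by
      intro x
      have := congrFun (iteratedDeriv_comp_add_const j (ψ : ℝ → ℂ) (2 * Real.pi)) x
      rw [← this, show (fun y => (ψ : ℝ → ℂ) (y + 2 * Real.pi)) = ψ from funext ψ.2.2]
    obtain ⟨B, hB⟩ := (hper.isBounded_of_continuous Real.two_pi_pos.ne' hcont).exists_norm_le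
    exact ⟨B, fun x => hB _ ⟨x, rfl⟩⟩
  choose B hB using h1
  refine ⟨∑ j ∈ Finset.range (K + 1), |B j|, fun j hj x => ?_⟩
  exact (hB j x).trans ((le_abs_self _).trans
    (Finset.single_le_sum (f := fun j => |B j|) (fun _ _ => abs_nonneg _)
      (Finset.mem_range.2 (Nat.lt_succ_of_le hj))))

theorem summable_coeff_mul_integral {c : ℤ → ℂ} (hc : PolyGrowth c) (ψ : TestFunction) :
    Summable fun n : ℤ => c n * ∫ x in (0 : ℝ)..(2 * Real.pi), (ψ : ℝ → ℂ) x * expFun n x := by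
  obtain ⟨C, k, hc⟩ := hc
  obtain ⟨M, hM⟩ := testFunction_bounded (k + 2) ψ
  exact Summable.of_norm_bounded (summable_one_add_abs_sq.mul_left _)
    (norm_coeff_mul_integral_le hc ψ M hM)

open Classical in
/-- The distribution `∑ₙ cₙ e^{inx}` with Fourier coefficients `c`, for a sequence `c` of polynomial
growth; the zero distribution for every other sequence. -/
noncomputable def ofCoeff (c : ℤ → ℂ) : Distribution :=
  if hc : PolyGrowth c then
    { toLin :=
        { toFun := fun ψ =>
            ∑' n : ℤ, c n * ∫ x in (0 : ℝ)..(2 * Real.pi), (ψ : ℝ → ℂ) x * expFun n x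
          map_add' := fun ψ χ => by
            rw [← (summable_coeff_mul_integral hc ψ).tsum_add (summable_coeff_mul_integral hc χ)]
            congr 1
            ext n
            rw [← mul_add, ← intervalIntegral.integral_add
              (f := fun x => (ψ : ℝ → ℂ) x * expFun n x) (g := fun x => (χ : ℝ → ℂ) x * expFun n x)
              ((ψ.2.1.continuous.mul (expFun_contDiff n).continuous).intervalIntegrable _ _)
              ((χ.2.1.continuous.mul (expFun_contDiff n).continuous).intervalIntegrable _ _)]
            simp [add_mul]
          map_smul' := fun a ψ => by
            rw [RingHom.id_apply, smul_eq_mul, ← tsum_mul_left]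
            congr 1
            ext n
            rw [mul_left_comm, ← intervalIntegral.integral_const_mul]
            simp [mul_assoc] }
      bound := by
        obtain ⟨C, k, hc'⟩ := hc
        refine ⟨C * (2 ^ (k + 2) * (4 * Real.pi)) * ∑' n : ℤ, ((1 + |(n : ℝ)|) ^ 2)⁻¹, k + 2,
          fun ψ M hM => ?_⟩
        refine (tsum_of_norm_bounded
          (summable_one_add_abs_sq.hasSum.mul_left (C * (2 ^ (k + 2) * (4 * Real.pi) * M)))
          (norm_coeff_mul_integral_le hc' ψ M hM)).trans (le_of_eq ?_)
        ring }
  else zeroDistribution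

/-- `⟨n⟩ = (1 + n²)^{1/2}`. -/
noncomputable def bracket (n : ℤ) : ℝ := Real.sqrt (1 + (n : ℝ) ^ 2)

/-- `u ∈ H^s(S¹)`, the complex Sobolev space: `∑ₙ ⟨n⟩^{2s} |û(n)|² < ∞`. -/
def MemSobolev (s : ℝ) (u : Distribution) : Prop :=
  Summable fun n : ℤ => bracket n ^ (2 * s) * ‖u.coeff n‖ ^ 2

/-- `u ∈ H^s(S¹)` has zero mean; `u` may be complex valued. -/
def MemSobolevZeroMean (s : ℝ) (u : Distribution) : Prop :=
  MemSobolev s u ∧ u.coeff 0 = 0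

/-- `u ∈ H^s(S¹)` is real valued and has zero mean. -/
def MemSobolevZeroMeanReal (s : ℝ) (u : Distribution) : Prop :=
  MemSobolevZeroMean s u ∧ ∀ n : ℤ, u.coeff n = (starRingEnd ℂ) (u.coeff (-n))

/-- `P₊`, the projector on the (strictly) positive frequencies. -/
noncomputable def posProj (u : Distribution) : Distribution :=
  ofCoeff fun n => if 0 < n then u.coeff n else 0

/-- `∂ₓ⁻¹`: the antiderivative of zero mean, for `u` of zero mean. -/
noncomputable def antideriv (u : Distribution) : Distribution :=
  ofCoeff fun n => if n = 0 then 0 else u.coeff n / (Complex.I * n)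

/-- The function `x ↦ ∑ₙ û(n) e^{inx}`, for `u` with absolutely summable Fourier coefficients. -/
noncomputable def Distribution.toFunction (u : Distribution) (x : ℝ) : ℂ :=
  ∑' n : ℤ, u.coeff n * expFun n x

/-- The product of `f ∈ H^r(S¹)` and `u ∈ H^{-r}(S¹)`, through its Fourier coefficients
`∑ₘ f̂(m) û(n - m)` (an absolutely convergent series). -/
noncomputable def mul (f u : Distribution) : Distribution :=
  ofCoeff fun n => ∑' m : ℤ, f.coeff m * u.coeff (n - m)

/-- `e^{-i ∂ₓ⁻¹ u}`, the pointwise exponential of the function `-i ∂ₓ⁻¹ u`. -/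
noncomputable def expAntideriv (u : Distribution) : Distribution :=
  ofFunction fun x => Complex.exp (-Complex.I * (antideriv u).toFunction x)

/-- Tao's gauge transform `Φ(u) = P₊(e^{-i ∂ₓ⁻¹ u} u)`. -/
noncomputable def gaugeTransform (u : Distribution) : Distribution :=
  posProj (mul (expAntideriv u) u)

/-- `Φ(u)` makes sense: for some `-1/2 < r < 0`, `u` is a real valued zero mean element of `H^r(S¹)`,
`∂ₓ⁻¹ u` is a function with absolutely convergent Fourier series, and `e^{-i ∂ₓ⁻¹ u} ∈ H^{-r}(S¹)`,
so that the product with `u` is defined by duality. -/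
def GaugeDefined (u : Distribution) : Prop :=
  ∃ r : ℝ, -1 / 2 < r ∧ r < 0 ∧ MemSobolevZeroMeanReal r u ∧
    (Summable fun n : ℤ => ‖(antideriv u).coeff n‖) ∧ MemSobolev (-r) (expAntideriv u)

end Deterministic

section Random

variable {Ω : Type*}

/-- `gₙ = (hₙ - i lₙ) / √2` for `n ≥ 1`, extended by `g₋ₙ = conj gₙ` (and, irrelevantly, `g₀ = 0`). -/
noncomputable def gaussCoeff (h l : ℕ+ → Ω → ℝ) (ω : Ω) (n : ℤ) : ℂ :=
  let k : ℕ+ := n.natAbs.toPNat'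
  if 0 < n then ((h k ω : ℂ) - Complex.I * (l k ω : ℂ)) / (Real.sqrt 2 : ℂ)
  else if n < 0 then ((h k ω : ℂ) + Complex.I * (l k ω : ℂ)) / (Real.sqrt 2 : ℂ)
  else 0

/-- The Fourier coefficients `gₙ(ω) / (2 √(π |n|))`, `n ≠ 0`, of the random series. -/
noncomputable def phiCoeff (h l : ℕ+ → Ω → ℝ) (ω : Ω) (n : ℤ) : ℂ :=
  if n = 0 then 0 else gaussCoeff h l ω n / (2 * Real.sqrt (Real.pi * |(n : ℝ)|) : ℝ)

/-- The random distribution `φ(ω, x) = ∑_{n ≠ 0} gₙ(ω) / (2 √(π |n|)) e^{inx}`. -/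
noncomputable def phi (h l : ℕ+ → Ω → ℝ) (ω : Ω) : Distribution := ofCoeff (phiCoeff h l ω)

end Random

end BenjaminOno

namespace BenjaminOno

/-! ### Fourier coefficients, Parseval and translations -/

section Fourier

open Filter Topology

/-! The variance of the `n`-th coefficient of the random series is of order `1/|n|`, so the expected
square of its `H^{-ε}` norm is finite for each `ε > 0`, and almost surely `u = φ(ω)` lies in
`H^{-ε}`. The rest is deterministic.

Put `v = ∂ₓ⁻¹ u ∈ H^{1-ε}`, with absolutely summable coefficients, and `F = e^{-iv}`. Formally `F' =
-i u F`, so the product `F u` equals `i F'` and has coefficients `-n F̂(n)`. The gauge transform is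
thus as regular as one derivative of `F`, and its zero mode is removed by `P₊`.

Two facts carry this. First, `F ∈ H^{1-2ε}`: since `v` is real, `|F(x) - F(y)| ≤ |v(x) - v(y)|`, so
`F` inherits the mean square modulus of continuity of `v`, and such a modulus gives back Sobolev
regularity with an arbitrarily small loss (`increment_fourierSeries_le`,
`sobolevSummable_of_increment_le`). Second, the chain rule holds for coefficients
(`tsum_fourierInt_expSeries`): the Taylor remainder of the exponential is quadratic in the
increments of `v`, hence `O(|h|^{2(1-ε)}) = o(h)` in mean.

Together they place `F u` in `H^{-2ε}` (`gaugeTransform_regular`), which is contained in `H^s` once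
`2ε ≤ -s`. -/

theorem expFun_add (m n : ℤ) (x : ℝ) : expFun (m + n) x = expFun m x * expFun n x := by
  unfold expFun
  rw [← Complex.exp_add]
  push_cast
  ring_nf

theorem expFun_add_apply (n : ℤ) (x y : ℝ) : expFun n (x + y) = expFun n x * expFun n y := by
  unfold expFun
  rw [← Complex.exp_add]
  push_cast
  ring_nf

theorem expFun_zero_left (x : ℝ) : expFun 0 x = 1 := by simp [expFun]

theorem expFun_zero_right (n : ℤ) : expFun n 0 = 1 := by simp [expFun]

theorem expFun_continuous (n : ℤ) : Continuous (expFun n) := (expFun_contDiff n).continuous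

theorem conj_expFun (n : ℤ) (x : ℝ) : (starRingEnd ℂ) (expFun n x) = expFun (-n) x := by
  unfold expFun
  rw [← Complex.exp_conj]
  simp

/-- The period is written `2π - 0` because `fourierCoeffOn` on `[0, 2π]` uses the circle of length
`b - a`. -/
theorem fourier_coe_eq_expFun (n : ℤ) (x : ℝ) :
    fourier n (x : AddCircle (2 * Real.pi - 0)) = expFun n x := by
  have : (Real.pi : ℂ) ≠ 0 := by exact_mod_cast Real.pi_ne_zero
  rw [fourier_coe_apply, expFun]
  congr 1
  push_cast
  field_simp
  ring

theorem integral_expFun (n : ℤ) :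
    ∫ x in (0 : ℝ)..(2 * Real.pi), expFun n x = if n = 0 then (2 * Real.pi : ℂ) else 0 := by
  split_ifs with hn
  · subst hn
    simp [expFun_zero_left]
  -- One integration by parts against the constant 1 gives `0 = -in ∫ e^{inx}`.
  · have h := integral_iteratedDeriv_mul_expFun n 1 (fun _ => 1) contDiff_const (fun _ => rfl)
    have hn' : (n : ℂ) ≠ 0 := by exact_mod_cast hn
    simpa [hn'] using h

theorem integral_expFun_mul_expFun (m n : ℤ) :
    ∫ x in (0 : ℝ)..(2 * Real.pi), expFun m x * expFun n x =
      if n = -m then (2 * Real.pi : ℂ) else 0 := by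
  simp_rw [← expFun_add, integral_expFun]
  congr 1
  rw [add_comm, add_eq_zero_iff_eq_neg]

/-- The Fourier coefficient `(2π)⁻¹ ∫ F(x) e^{-inx} dx` of a function. -/
noncomputable def fourierInt (F : ℝ → ℂ) (n : ℤ) : ℂ :=
  (2 * Real.pi : ℂ)⁻¹ * ∫ x in (0 : ℝ)..(2 * Real.pi), F x * expFun (-n) x

theorem coeff_ofFunction {F : ℝ → ℂ} (hF : Continuous F) (n : ℤ) :
    (ofFunction F).coeff n = fourierInt F n := by
  unfold ofFunction Distribution.coeff fourierInt
  rw [dif_pos (hF.intervalIntegrable _ _)]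
  rfl

theorem coeff_ofCoeff {c : ℤ → ℂ} (hc : PolyGrowth c) (n : ℤ) : (ofCoeff c).coeff n = c n := by
  unfold ofCoeff Distribution.coeff
  rw [dif_pos hc]
  change (2 * Real.pi : ℂ)⁻¹ *
    ∑' k : ℤ, c k * ∫ x in (0 : ℝ)..(2 * Real.pi), expFun (-n) x * expFun k x = c n
  simp_rw [integral_expFun_mul_expFun, neg_neg]
  rw [tsum_eq_single n (fun k hk => by simp [hk]), if_pos rfl]
  have : (Real.pi : ℂ) ≠ 0 := by exact_mod_cast Real.pi_ne_zero
  field_simp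

theorem hasSum_sq_fourierInt {F : ℝ → ℂ} (hF : Continuous F) :
    HasSum (fun n => ‖fourierInt F n‖ ^ 2)
      ((2 * Real.pi)⁻¹ * ∫ x in (0 : ℝ)..(2 * Real.pi), ‖F x‖ ^ 2) := by
  have hL2 : MemLp F 2 (volume.restrict (Set.Ioc 0 (2 * Real.pi))) := by
    obtain ⟨C, hC⟩ := (isCompact_Icc (a := (0 : ℝ)) (b := 2 * Real.pi)).exists_bound_of_continuousOn
      hF.continuousOn
    refine MemLp.of_bound hF.aestronglyMeasurable C ?_
    filter_upwards [ae_restrict_mem measurableSet_Ioc] with x hx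
    exact hC x (Set.Ioc_subset_Icc_self hx)
  have h := hasSum_sq_fourierCoeffOn Real.two_pi_pos hL2
  simp only [fourierCoeffOn_eq_integral, fourier_coe_eq_expFun, sub_zero, smul_eq_mul] at h
  convert h using 4 with n
  rw [fourierInt, Complex.real_smul]
  push_cast
  simp_rw [mul_comm (F _), one_div]

theorem norm_fourierInt_le {F : ℝ → ℂ} {C : ℝ} (hF : ∀ x, ‖F x‖ ≤ C) (n : ℤ) :
    ‖fourierInt F n‖ ≤ C := by
  have h : ‖∫ x in (0 : ℝ)..(2 * Real.pi), F x * expFun (-n) x‖ ≤ C * |2 * Real.pi - 0| :=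
    intervalIntegral.norm_integral_le_of_norm_le_const fun x _ => by
      rw [norm_mul, expFun_norm, mul_one]
      exact hF x
  rw [sub_zero, abs_of_pos Real.two_pi_pos] at h
  rw [fourierInt, norm_mul, norm_inv, norm_mul, Complex.norm_ofNat, Complex.norm_real,
    Real.norm_of_nonneg Real.pi_pos.le, inv_mul_le_iff₀ Real.two_pi_pos]
  linarith

theorem fourierInt_sub {F G : ℝ → ℂ} (hF : Continuous F) (hG : Continuous G) (n : ℤ) :
    fourierInt (fun x => F x - G x) n = fourierInt F n - fourierInt G n := by
  unfold fourierInt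
  simp_rw [sub_mul]
  rw [← mul_sub]
  congr 1
  exact intervalIntegral.integral_sub ((hF.mul (expFun_continuous _)).intervalIntegrable _ _)
    ((hG.mul (expFun_continuous _)).intervalIntegrable _ _)

theorem fourierInt_comp_add {F : ℝ → ℂ} (hp : Function.Periodic F (2 * Real.pi)) (h : ℝ) (n : ℤ) :
    fourierInt (fun x => F (x + h)) n = expFun n h * fourierInt F n := by
  unfold fourierInt
  have h1 : ∀ x, F (x + h) * expFun (-n) x = expFun n h * (F (x + h) * expFun (-n) (x + h)) := by
    intro x
    rw [expFun_add_apply]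
    have : expFun n h * expFun (-n) h = 1 := by
      rw [← expFun_add, add_neg_cancel, expFun_zero_left]
    linear_combination (- F (x + h) * expFun (-n) x) * this
  simp_rw [h1]
  have hper : Function.Periodic (fun x => F x * expFun (-n) x) (2 * Real.pi) :=
    hp.mul (expFun_periodic _)
  rw [intervalIntegral.integral_const_mul,
    intervalIntegral.integral_comp_add_right (fun x => F x * expFun (-n) x) h]
  have := hper.intervalIntegral_add_eq h 0
  rw [zero_add, add_comm h] at this
  rw [zero_add, this]
  ring

theorem fourierInt_translate_sub {F : ℝ → ℂ} (hF : Continuous F)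
    (hp : Function.Periodic F (2 * Real.pi)) (h : ℝ) (n : ℤ) :
    fourierInt (fun x => F (x + h) - F x) n = (expFun n h - 1) * fourierInt F n := by
  rw [fourierInt_sub (by fun_prop) hF, fourierInt_comp_add hp]
  ring

/-- The sum of an absolutely convergent Fourier series. -/
noncomputable def fourierSeries (w : ℤ → ℂ) (x : ℝ) : ℂ := ∑' k : ℤ, w k * expFun k x

theorem summable_fourierSeries {w : ℤ → ℂ} (hw : Summable fun k => ‖w k‖) (x : ℝ) :
    Summable fun k => w k * expFun k x :=
  Summable.of_norm (by simpa [expFun_norm] using hw)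

theorem fourierSeries_continuous {w : ℤ → ℂ} (hw : Summable fun k => ‖w k‖) :
    Continuous (fourierSeries w) :=
  continuous_tsum (fun k => continuous_const.mul (expFun_continuous k)) hw
    (fun k x => by simp [expFun_norm])

theorem fourierSeries_periodic (w : ℤ → ℂ) : Function.Periodic (fourierSeries w) (2 * Real.pi) := by
  intro x
  unfold fourierSeries
  simp_rw [(expFun_periodic _) x]

theorem fourierSeries_translate_sub {w : ℤ → ℂ} (hw : Summable fun k => ‖w k‖) (h x : ℝ) :
    fourierSeries w (x + h) - fourierSeries w x =
      fourierSeries (fun k => w k * (expFun k h - 1)) x := by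
  unfold fourierSeries
  rw [← (summable_fourierSeries hw _).tsum_sub (summable_fourierSeries hw _)]
  congr 1
  ext k
  rw [expFun_add_apply]
  ring

/-- Termwise integration, dominated by `C ‖w k‖`; only one of the two factors needs an absolutely
convergent Fourier series. -/
theorem hasSum_fourierInt_mul_fourierSeries {F : ℝ → ℂ} (hF : Continuous F) {w : ℤ → ℂ}
    (hw : Summable fun k => ‖w k‖) (n : ℤ) :
    HasSum (fun k => w k * fourierInt F (n - k)) (fourierInt (fun x => F x * fourierSeries w x) n) := by
  obtain ⟨C, hC⟩ := (isCompact_uIcc (a := (0 : ℝ)) (b := 2 * Real.pi)).exists_bound_of_continuousOn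
      hF.continuousOn
  have h := intervalIntegral.hasSum_integral_of_dominated_convergence (μ := volume)
    (a := 0) (b := 2 * Real.pi) (F := fun k x => F x * (w k * expFun k x) * expFun (-n) x)
    (f := fun x => F x * fourierSeries w x * expFun (-n) x)
    (fun k _ => C * ‖w k‖)
    (fun k => (((hF.mul (continuous_const.mul (expFun_continuous k))).mul
      (expFun_continuous _))).aestronglyMeasurable)
    (fun k => Eventually.of_forall fun x hx => by
      rw [norm_mul, norm_mul, norm_mul, expFun_norm, expFun_norm, mul_one, mul_one]
      gcongr
      exact hC x (Set.uIoc_subset_uIcc hx))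
    (Eventually.of_forall fun x _ => hw.mul_left C)
    (by simp)
    (Eventually.of_forall fun x _ => ((summable_fourierSeries hw x).hasSum.mul_left _).mul_right _)
  refine (congrArg (HasSum · _) (funext fun k => ?_)).mpr (h.mul_left ((2 * Real.pi : ℂ)⁻¹))
  unfold fourierInt
  rw [mul_left_comm, ← intervalIntegral.integral_const_mul]
  congr 2
  ext x
  rw [show -(n - k) = k + -n by ring, expFun_add]
  ring

theorem fourierInt_fourierSeries {w : ℤ → ℂ} (hw : Summable fun k => ‖w k‖) (n : ℤ) :
    fourierInt (fourierSeries w) n = w n := by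
  have h := hasSum_fourierInt_mul_fourierSeries (F := fun _ => 1) continuous_const hw n
  have h1 : ∀ k, fourierInt (fun _ => 1) k = if k = 0 then 1 else 0 := by
    intro k
    have : (Real.pi : ℂ) ≠ 0 := by exact_mod_cast Real.pi_ne_zero
    simp only [fourierInt, one_mul, integral_expFun, neg_eq_zero]
    split_ifs <;> field_simp
    simp
  simp only [one_mul, h1] at h
  refine (h.unique ?_).trans rfl
  convert hasSum_ite_eq n (w n) using 2 with k
  by_cases hk : k = n
  · simp [hk]
  · simp [hk, sub_eq_zero, Ne.symm hk]

end Fourier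

/-! ### Sobolev regularity and mean square increments -/

section Sobolev

open Filter Topology

theorem one_le_bracket (n : ℤ) : 1 ≤ bracket n :=
  Real.one_le_sqrt.2 (by nlinarith [sq_nonneg (n : ℝ)])

theorem bracket_pos (n : ℤ) : 0 < bracket n := one_pos.trans_le (one_le_bracket n)

theorem bracket_sq (n : ℤ) : bracket n ^ 2 = 1 + (n : ℝ) ^ 2 := Real.sq_sqrt (by positivity)

theorem abs_le_bracket (n : ℤ) : |(n : ℝ)| ≤ bracket n := by
  rw [bracket, ← Real.sqrt_sq_eq_abs]
  exact Real.sqrt_le_sqrt (by linarith)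

theorem bracket_le_one_add_abs (n : ℤ) : bracket n ≤ 1 + |(n : ℝ)| := by
  rw [bracket]
  refine Real.sqrt_le_iff.2 ⟨by positivity, ?_⟩
  nlinarith [abs_nonneg (n : ℝ), sq_abs (n : ℝ)]

theorem bracket_le_two_mul_abs {n : ℤ} (hn : n ≠ 0) : bracket n ≤ 2 * |(n : ℝ)| := by
  have : (1 : ℝ) ≤ |(n : ℝ)| := by exact_mod_cast Int.one_le_abs hn
  linarith [bracket_le_one_add_abs n]

/-- Peetre's inequality, which moves a weight from one frequency to another across a convolution. -/
theorem bracket_le_mul (m n : ℤ) : bracket m ≤ 2 * bracket n * bracket (n - m) := by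
  have h1 := bracket_sq m
  have h2 := bracket_sq n
  have h3 := bracket_sq (n - m)
  push_cast at h3
  have hp := bracket_pos n
  have hq := bracket_pos (n - m)
  refine abs_le_of_sq_le_sq' ?_ (by positivity) |>.2
  rw [mul_pow, mul_pow, h1, h2, h3]
  nlinarith [sq_nonneg ((n : ℝ) * (n - m)), sq_nonneg ((m : ℝ) - 2 * n), sq_nonneg ((n : ℝ)),
    sq_nonneg ((n : ℝ) - m)]

theorem bracket_rpow_pos (n : ℤ) (s : ℝ) : 0 < bracket n ^ s := Real.rpow_pos_of_pos (bracket_pos n) s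

theorem MemSobolev.mono {s t : ℝ} (hst : s ≤ t) {u : Distribution} (hu : MemSobolev t u) :
    MemSobolev s u := by
  refine Summable.of_nonneg_of_le
    (fun n => mul_nonneg (bracket_rpow_pos n _).le (sq_nonneg _)) (fun n => ?_) hu
  have := one_le_bracket n
  gcongr

theorem norm_expFun_sub_one_le (n : ℤ) (h : ℝ) : ‖expFun n h - 1‖ ≤ |(n : ℝ)| * |h| := by
  have := Real.norm_exp_I_mul_ofReal_sub_one_le (x := n * h)
  rw [Real.norm_eq_abs, abs_mul] at this
  refine le_trans (le_of_eq ?_) this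
  unfold expFun
  push_cast
  ring_nf

/-- Interpolation between the Lipschitz bound `|nh|`, used when `|nh| ≤ 1`, and the trivial bound 2,
whose square is the constant 4. -/
theorem norm_expFun_sub_one_sq_le (n : ℤ) (h : ℝ) {τ : ℝ} (h0 : 0 ≤ τ) (h1 : τ ≤ 1) :
    ‖expFun n h - 1‖ ^ 2 ≤ 4 * (|(n : ℝ)| * |h|) ^ (2 * τ) := by
  set a := |(n : ℝ)| * |h|
  have ha : 0 ≤ a := by positivity
  rcases le_total a 1 with h' | h'
  · calc ‖expFun n h - 1‖ ^ 2 ≤ a ^ 2 := by gcongr; exact norm_expFun_sub_one_le n h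
      _ = a ^ (2 : ℝ) := (Real.rpow_two a).symm
      _ ≤ a ^ (2 * τ) := by
        rcases ha.eq_or_lt with h0' | h0'
        · rw [← h0', Real.zero_rpow two_ne_zero]
          positivity
        · exact Real.rpow_le_rpow_of_exponent_ge h0' h' (by linarith)
      _ ≤ _ := by linarith [Real.rpow_nonneg ha (2 * τ)]
  · have h2 : ‖expFun n h - 1‖ ≤ 2 := by
      refine (norm_sub_le _ _).trans ?_
      rw [expFun_norm, norm_one]
      norm_num
    have h3 : 1 ≤ a ^ (2 * τ) := Real.one_le_rpow h' (by linarith)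
    nlinarith [norm_nonneg (expFun n h - 1)]

theorem two_le_norm_expFun_sub_one_sq {n : ℤ} {h : ℝ} (h1 : Real.pi / 2 ≤ |(n : ℝ) * h|)
    (h2 : |(n : ℝ) * h| ≤ Real.pi) : 2 ≤ ‖expFun n h - 1‖ ^ 2 := by
  have hc : Real.cos (n * h) ≤ 0 := by
    rw [← Real.cos_abs]
    exact Real.cos_nonpos_of_pi_div_two_le_of_le h1 (by linarith [Real.pi_pos])
  have he : expFun n h = Complex.exp ((n * h : ℝ) * Complex.I) := by
    unfold expFun
    push_cast
    ring_nf
  rw [he, Complex.exp_mul_I, ← Complex.ofReal_cos, ← Complex.ofReal_sin, Complex.sq_norm,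
    Complex.normSq_apply]
  have hsc := Real.sin_sq_add_cos_sq (n * h)
  generalize Real.cos (n * h) = c at *
  generalize Real.sin (n * h) = d at *
  simp
  nlinarith

/-- The dyadic scale at which `e^{inx}` oscillates, for `n ≠ 0`. -/
theorem exists_dyadic_scale {n : ℤ} (hn : n ≠ 0) :
    ∃ j : ℕ, bracket n ≤ 2 ^ j ∧ 2 ≤ ‖expFun n (Real.pi / 2 ^ j) - 1‖ ^ 2 := by
  have hN : n.natAbs ≠ 0 := Int.natAbs_ne_zero.2 hn
  have e1 := Nat.lt_pow_succ_log_self (b := 2) one_lt_two n.natAbs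
  have e2 := Nat.pow_log_le_self 2 hN
  set j := Nat.log 2 n.natAbs
  have habs : |(n : ℝ)| = (n.natAbs : ℝ) := by
    rw [Nat.cast_natAbs, Int.cast_abs]
  have f1 : |(n : ℝ)| + 1 ≤ 2 ^ (j + 1) := by
    rw [habs]
    exact_mod_cast e1
  have f2 : (2 : ℝ) ^ j ≤ |(n : ℝ)| := by
    rw [habs]
    exact_mod_cast e2
  have hpi := Real.pi_pos
  have hval : |(n : ℝ) * (Real.pi / 2 ^ (j + 1))| = |(n : ℝ)| * (Real.pi / 2 ^ (j + 1)) := by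
    rw [abs_mul, abs_of_pos (a := Real.pi / 2 ^ (j + 1)) (by positivity)]
  -- From `2^j ≤ |n| < 2^(j+1)` the phase `|n| π / 2^(j+1)` lies in `[π/2, π]`, where the cosine is
  -- nonpositive.
  refine ⟨j + 1, by linarith [bracket_le_one_add_abs n], two_le_norm_expFun_sub_one_sq ?_ ?_⟩
  · rw [hval, mul_div_assoc', le_div_iff₀ (by positivity), pow_succ]
    nlinarith
  · rw [hval, mul_div_assoc', div_le_iff₀ (by positivity)]
    nlinarith

/-- The `H^s` summability of a sequence of Fourier coefficients. -/
def SobolevSummable (s : ℝ) (c : ℤ → ℂ) : Prop :=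
  Summable fun n : ℤ => bracket n ^ (2 * s) * ‖c n‖ ^ 2

/-- The mean square of the increments of step `h` over a period. -/
noncomputable def increment (F : ℝ → ℂ) (h : ℝ) : ℝ :=
  (2 * Real.pi)⁻¹ * ∫ x in (0 : ℝ)..(2 * Real.pi), ‖F (x + h) - F x‖ ^ 2

/-- By Parseval the increment is `∑ |e^{inh} - 1|² |w n|²`, and each factor `|e^{inh} - 1|²` is at
most `4 |nh|^{2τ}`. -/
theorem increment_fourierSeries_le {w : ℤ → ℂ} (hw : Summable fun k => ‖w k‖) {τ : ℝ}
    (h0 : 0 ≤ τ) (h1 : τ ≤ 1) (hs : SobolevSummable τ w) (h : ℝ) :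
    increment (fourierSeries w) h ≤
      4 * |h| ^ (2 * τ) * ∑' n : ℤ, bracket n ^ (2 * τ) * ‖w n‖ ^ 2 := by
  have hc := fourierSeries_continuous hw
  have hp := hasSum_sq_fourierInt (F := fun x => fourierSeries w (x + h) - fourierSeries w x)
    (by fun_prop)
  simp only [fourierInt_translate_sub hc (fourierSeries_periodic w),
    fourierInt_fourierSeries hw] at hp
  refine hasSum_le (fun n => ?_) hp (hs.hasSum.mul_left _)
  rw [norm_mul, mul_pow]
  have e := norm_expFun_sub_one_sq_le n h h0 h1
  rw [Real.mul_rpow (abs_nonneg _) (abs_nonneg _)] at e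
  have e2 : |(n : ℝ)| ^ (2 * τ) ≤ bracket n ^ (2 * τ) := by
    have := abs_le_bracket n
    gcongr
  calc ‖expFun n h - 1‖ ^ 2 * ‖w n‖ ^ 2
      ≤ 4 * (|(n : ℝ)| ^ (2 * τ) * |h| ^ (2 * τ)) * ‖w n‖ ^ 2 := by gcongr
    _ ≤ 4 * (bracket n ^ (2 * τ) * |h| ^ (2 * τ)) * ‖w n‖ ^ 2 := by gcongr
    _ = _ := by ring

theorem sum_fourierInt_le_increment {F : ℝ → ℂ} (hF : Continuous F)
    (hp : Function.Periodic F (2 * Real.pi)) (h : ℝ) (S : Finset ℤ) :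
    ∑ n ∈ S, ‖expFun n h - 1‖ ^ 2 * ‖fourierInt F n‖ ^ 2 ≤ increment F h := by
  have hs := hasSum_sq_fourierInt (F := fun x => F (x + h) - F x) (by fun_prop)
  simp only [fourierInt_translate_sub hF hp, norm_mul, mul_pow] at hs
  exact sum_le_hasSum S (fun n _ => by positivity) hs

theorem increment_le_of_norm_sub_le {F G : ℝ → ℂ} (hF : Continuous F) (hG : Continuous G)
    (hFG : ∀ x y, ‖F x - F y‖ ≤ ‖G x - G y‖) (h : ℝ) : increment F h ≤ increment G h := by
  unfold increment
  refine mul_le_mul_of_nonneg_left ?_ (by positivity)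
  refine intervalIntegral.integral_mono_on Real.two_pi_pos.le
    (Continuous.intervalIntegrable (by fun_prop) _ _)
    (Continuous.intervalIntegrable (by fun_prop) _ _) fun x _ => ?_
  have := hFG (x + h) x
  gcongr

/-- Periodic functions whose increments are `O(h^τ)` in mean square are in `H^σ` for `σ < τ`. -/
theorem sobolevSummable_of_increment_le {F : ℝ → ℂ} (hF : Continuous F)
    (hp : Function.Periodic F (2 * Real.pi)) {σ τ A : ℝ} (h0 : 0 ≤ σ) (hστ : σ < τ)
    (hA : ∀ h, increment F h ≤ A * |h| ^ (2 * τ)) : SobolevSummable σ (fourierInt F) := by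
  have key : ∀ n : ℤ, ∃ j : ℕ, n ≠ 0 →
      bracket n ≤ 2 ^ j ∧ 2 ≤ ‖expFun n (Real.pi / 2 ^ j) - 1‖ ^ 2 := by
    intro n
    by_cases hn : n = 0
    · exact ⟨0, fun h => absurd hn h⟩
    · obtain ⟨j, hj⟩ := exists_dyadic_scale hn
      exact ⟨j, fun _ => hj⟩
  choose J hJ using key
  -- Ratio of the geometric series over dyadic scales; the strict inequality `σ < τ` makes it less
  -- than 1.
  set q : ℝ := 2 ^ (2 * σ - 2 * τ) with hq
  have hq0 : 0 < q := by positivity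
  have hq1 : q < 1 := Real.rpow_lt_one_of_one_lt_of_neg one_lt_two (by linarith)
  have hA0 : 0 ≤ A := by
    have h1 := sum_fourierInt_le_increment hF hp 1 ∅
    have h2 := hA 1
    simp at h1 h2
    linarith
  have hgeo := summable_geometric_of_lt_one hq0.le hq1
  set B := A * Real.pi ^ (2 * τ)
  have hscale : ∀ j : ℕ, ((2 : ℝ) ^ j) ^ (2 * σ) * increment F (Real.pi / 2 ^ j) ≤ B * q ^ j := by
    intro j
    have hpi := Real.pi_pos
    have e := hA (Real.pi / 2 ^ j)
    rw [abs_of_pos (by positivity), Real.div_rpow hpi.le (by positivity)] at e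
    calc ((2 : ℝ) ^ j) ^ (2 * σ) * increment F (Real.pi / 2 ^ j)
        ≤ ((2 : ℝ) ^ j) ^ (2 * σ) * (A * (Real.pi ^ (2 * τ) / ((2 : ℝ) ^ j) ^ (2 * τ))) := by gcongr
      _ = B * (((2 : ℝ) ^ j) ^ (2 * σ) / ((2 : ℝ) ^ j) ^ (2 * τ)) := by ring
      _ = B * q ^ j := by
        rw [← Real.rpow_sub (by positivity), hq, ← Real.rpow_natCast, ← Real.rpow_natCast,
          ← Real.rpow_mul zero_le_two, ← Real.rpow_mul zero_le_two, mul_comm (j : ℝ)]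
  refine summable_of_sum_le (c := ‖fourierInt F 0‖ ^ 2 + B * ∑' j, q ^ j)
    (fun n => mul_nonneg (bracket_rpow_pos n _).le (sq_nonneg _)) fun S => ?_
  set N := S.sup J + 1
  -- Each nonzero frequency is charged to its own scale `J n`; the other scales contribute
  -- nonnegative terms. The zero mode is kept apart, as no translation detects it.
  have hpt : ∀ n ∈ S, bracket n ^ (2 * σ) * ‖fourierInt F n‖ ^ 2 ≤
      (if n = 0 then ‖fourierInt F 0‖ ^ 2 else 0) + ∑ j ∈ Finset.range N,
        ((2 : ℝ) ^ j) ^ (2 * σ) *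
          (‖expFun n (Real.pi / 2 ^ j) - 1‖ ^ 2 * ‖fourierInt F n‖ ^ 2) := by
    intro n hn
    have hnn : ∀ j ∈ Finset.range N, 0 ≤ ((2 : ℝ) ^ j) ^ (2 * σ) *
          (‖expFun n (Real.pi / 2 ^ j) - 1‖ ^ 2 * ‖fourierInt F n‖ ^ 2) :=
      fun j _ => by positivity
    by_cases h : n = 0
    · subst h
      have : bracket 0 = 1 := by simp [bracket]
      rw [if_pos rfl, this, Real.one_rpow, one_mul]
      linarith [Finset.sum_nonneg hnn]
    · rw [if_neg h, zero_add]
      have hmem : J n ∈ Finset.range N :=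
        Finset.mem_range.2 (Nat.lt_succ_of_le (Finset.le_sup hn))
      refine le_trans ?_ (Finset.single_le_sum hnn hmem)
      have h1 : bracket n ^ (2 * σ) ≤ ((2 : ℝ) ^ J n) ^ (2 * σ) := by
        have := (hJ n h).1
        have := bracket_pos n
        gcongr
      have h2 : (1 : ℝ) ≤ ‖expFun n (Real.pi / 2 ^ J n) - 1‖ ^ 2 := by linarith [(hJ n h).2]
      refine mul_le_mul h1 ?_ (by positivity) (by positivity)
      exact le_mul_of_one_le_left (by positivity) h2
  refine (Finset.sum_le_sum hpt).trans ?_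
  rw [Finset.sum_add_distrib]
  refine add_le_add ?_ ?_
  · rw [Finset.sum_ite_eq' S 0]
    split_ifs
    · exact le_rfl
    · positivity
  -- With the scale summed last, the sum over frequencies at a fixed step is at most the increment.
  · rw [Finset.sum_comm, ← tsum_mul_left]
    refine le_trans (Finset.sum_le_sum fun j _ => ?_)
      ((hgeo.mul_left B).sum_le_tsum (Finset.range N) fun j _ => by positivity)
    rw [← Finset.mul_sum]
    refine le_trans ?_ (hscale j)
    gcongr
    exact sum_fourierInt_le_increment hF hp _ S

end Sobolev

/-! ### The chain rule for the exponential -/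

section ChainRule

open Filter Topology

theorem fourierSeries_eq_ofReal_re {w : ℤ → ℂ} (hreal : ∀ k, w k = (starRingEnd ℂ) (w (-k)))
    (x : ℝ) : fourierSeries w x = ((fourierSeries w x).re : ℂ) := by
  rw [eq_comm, ← Complex.conj_eq_iff_re, fourierSeries, Complex.conj_tsum,
    ← (Equiv.neg ℤ).tsum_eq]
  congr 1
  ext k
  rw [Equiv.neg_apply, map_mul, ← hreal k, conj_expFun, neg_neg]

theorem norm_cexp_sub_one_le (θ : ℝ) : ‖Complex.exp (-Complex.I * θ) - 1‖ ≤ |θ| := by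
  have := Real.norm_exp_I_mul_ofReal_sub_one_le (x := -θ)
  rw [norm_neg, Real.norm_eq_abs] at this
  refine le_trans (le_of_eq ?_) this
  push_cast
  ring_nf

/-- Taylor's formula for `|θ| ≤ 1`; otherwise the left side is at most `2|θ| ≤ 2|θ|²`. -/
theorem norm_cexp_sub_one_add_le (θ : ℝ) :
    ‖Complex.exp (-Complex.I * θ) - 1 + Complex.I * θ‖ ≤ 2 * ‖(θ : ℂ)‖ ^ 2 := by
  have hn : ‖-Complex.I * (θ : ℂ)‖ = ‖(θ : ℂ)‖ := by simp
  rcases le_total ‖(θ : ℂ)‖ 1 with h | h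
  · have := Complex.norm_exp_sub_one_sub_id_le (hn.trans_le h)
    rw [hn, neg_mul, sub_neg_eq_add] at this
    rw [neg_mul]
    nlinarith [sq_nonneg ‖(θ : ℂ)‖]
  · have h1 := norm_cexp_sub_one_le θ
    rw [← Real.norm_eq_abs, ← Complex.norm_real] at h1
    refine (norm_add_le _ _).trans ?_
    rw [norm_mul, Complex.norm_I, one_mul]
    nlinarith

/-- The function `e^{-iv}`, where `v` is the sum of a Fourier series. -/
noncomputable def expSeries (w : ℤ → ℂ) (x : ℝ) : ℂ :=
  Complex.exp (-Complex.I * fourierSeries w x)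

theorem expSeries_continuous {w : ℤ → ℂ} (hw : Summable fun k => ‖w k‖) :
    Continuous (expSeries w) :=
  (continuous_const.mul (fourierSeries_continuous hw)).cexp

theorem expSeries_periodic (w : ℤ → ℂ) : Function.Periodic (expSeries w) (2 * Real.pi) := by
  intro x
  rw [expSeries, fourierSeries_periodic, expSeries]

theorem expSeries_eq_mul (w : ℤ → ℂ) (x y : ℝ) :
    expSeries w x =
      expSeries w y * Complex.exp (-Complex.I * (fourierSeries w x - fourierSeries w y)) := by
  rw [expSeries, expSeries, ← Complex.exp_add]
  ring_nf

theorem norm_expSeries {w : ℤ → ℂ} (hreal : ∀ k, w k = (starRingEnd ℂ) (w (-k))) (x : ℝ) :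
    ‖expSeries w x‖ = 1 := by
  rw [expSeries, fourierSeries_eq_ofReal_re hreal, Complex.norm_exp]
  simp

theorem norm_expSeries_sub_le {w : ℤ → ℂ} (hreal : ∀ k, w k = (starRingEnd ℂ) (w (-k)))
    (x y : ℝ) :
    ‖expSeries w x - expSeries w y‖ ≤ ‖fourierSeries w x - fourierSeries w y‖ := by
  rw [expSeries_eq_mul w x y, ← mul_sub_one, norm_mul, norm_expSeries hreal, one_mul,
    fourierSeries_eq_ofReal_re hreal x, fourierSeries_eq_ofReal_re hreal y, ← Complex.ofReal_sub,
    Complex.norm_real, Real.norm_eq_abs]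
  exact norm_cexp_sub_one_le _

theorem norm_expSeries_remainder_le {w : ℤ → ℂ} (hreal : ∀ k, w k = (starRingEnd ℂ) (w (-k)))
    (x y : ℝ) :
    ‖expSeries w x - expSeries w y +
        Complex.I * (expSeries w y * (fourierSeries w x - fourierSeries w y))‖ ≤
      2 * ‖fourierSeries w x - fourierSeries w y‖ ^ 2 := by
  have : expSeries w x - expSeries w y +
        Complex.I * (expSeries w y * (fourierSeries w x - fourierSeries w y)) =
      expSeries w y * (Complex.exp (-Complex.I * (fourierSeries w x - fourierSeries w y)) - 1 +
        Complex.I * (fourierSeries w x - fourierSeries w y)) := by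
    rw [expSeries_eq_mul w x y]
    ring
  rw [this, norm_mul, norm_expSeries hreal, one_mul,
    fourierSeries_eq_ofReal_re hreal x, fourierSeries_eq_ofReal_re hreal y, ← Complex.ofReal_sub]
  exact norm_cexp_sub_one_add_le _

theorem norm_fourierInt_le_of_norm_le {G : ℝ → ℂ} {g : ℝ → ℝ} (hg : Continuous g)
    (hGg : ∀ x, ‖G x‖ ≤ g x) (n : ℤ) :
    ‖fourierInt G n‖ ≤ (2 * Real.pi)⁻¹ * ∫ x in (0 : ℝ)..(2 * Real.pi), g x := by
  rw [fourierInt, norm_mul, norm_inv, norm_mul, Complex.norm_ofNat, Complex.norm_real,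
    Real.norm_of_nonneg Real.pi_pos.le]
  refine mul_le_mul_of_nonneg_left ?_ (by positivity)
  refine intervalIntegral.norm_integral_le_of_norm_le Real.two_pi_pos.le ?_
    (hg.intervalIntegrable _ _)
  refine Eventually.of_forall fun x _ => ?_
  rw [norm_mul, expFun_norm, mul_one]
  exact hGg x

theorem tendsto_expFun_slope (k : ℤ) :
    Tendsto (fun h : ℝ => (h : ℂ)⁻¹ * (expFun k h - 1)) (𝓝[≠] 0) (𝓝 (Complex.I * k)) := by
  have h := (expFun_hasDerivAt k 0).tendsto_slope_zero
  simp only [zero_add, expFun_zero_right, mul_one] at h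
  refine h.congr fun t => ?_
  rw [Complex.real_smul, Complex.ofReal_inv]

theorem norm_expFun_slope_le (k : ℤ) (h : ℝ) :
    ‖(h : ℂ)⁻¹ * (expFun k h - 1)‖ ≤ |(k : ℝ)| := by
  rcases eq_or_ne h 0 with rfl | hh
  · simp
  · rw [norm_mul, norm_inv, Complex.norm_real, Real.norm_eq_abs,
      inv_mul_le_iff₀ (abs_pos.2 hh), mul_comm |h|]
    exact norm_expFun_sub_one_le k h

/-- The chain rule `(e^{-iv})' = -i v' e^{-iv}`, in terms of Fourier coefficients. -/
theorem tsum_fourierInt_expSeries {w : ℤ → ℂ} (hw : Summable fun k => ‖w k‖)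
    (hreal : ∀ k, w k = (starRingEnd ℂ) (w (-k))) {τ : ℝ} (h0 : 1 / 2 < τ) (h1 : τ ≤ 1)
    (hs : SobolevSummable τ w) (n : ℤ)
    (hconv : Summable fun k : ℤ => |(k : ℝ)| * ‖w k‖ * ‖fourierInt (expSeries w) (n - k)‖) :
    ∑' k : ℤ, fourierInt (expSeries w) (n - k) * (Complex.I * k * w k) =
      -n * fourierInt (expSeries w) n := by
  set F := expSeries w with hFdef
  set W := fourierSeries w with hWdef
  have hF : Continuous F := expSeries_continuous hw
  have hW : Continuous W := fourierSeries_continuous hw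
  -- `R h` is the `n`-th coefficient of the first order Taylor remainder `F(x+h) - F(x) + i F(x)
  -- (W(x+h) - W(x))`. The limit of `R h / h` is computed twice.
  set R : ℝ → ℂ := fun h => (expFun n h - 1) * fourierInt F n +
    Complex.I * ∑' k : ℤ, w k * (expFun k h - 1) * fourierInt F (n - k) with hR
  have hRbound : ∀ h, ‖R h‖ ≤ 2 * increment W h := by
    intro h
    have hwh : Summable fun k => ‖w k * (expFun k h - 1)‖ := by
      refine Summable.of_nonneg_of_le (fun _ => norm_nonneg _) (fun k => ?_) (hw.mul_right 2)
      rw [norm_mul]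
      gcongr
      refine (norm_sub_le _ _).trans ?_
      rw [expFun_norm, norm_one]
      norm_num
    have e : R h = fourierInt (fun x => F (x + h) - F x +
        Complex.I * (F x * (W (x + h) - W x))) n := by
      rw [hR]
      simp only
      rw [(hasSum_fourierInt_mul_fourierSeries hF hwh n).tsum_eq,
        ← fourierInt_translate_sub hF (expSeries_periodic w)]
      simp_rw [← fourierSeries_translate_sub hw h, ← hWdef]
      unfold fourierInt
      rw [mul_left_comm, ← mul_add, ← intervalIntegral.integral_const_mul,
        ← intervalIntegral.integral_add
          (Continuous.intervalIntegrable (by have := expFun_continuous (-n); fun_prop) _ _)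
          (Continuous.intervalIntegrable (by have := expFun_continuous (-n); fun_prop) _ _)]
      congr 2
      ext x
      ring
    rw [e]
    refine (norm_fourierInt_le_of_norm_le (g := fun x => 2 * ‖W (x + h) - W x‖ ^ 2) (by fun_prop)
      (fun x => norm_expSeries_remainder_le hreal (x + h) x) n).trans (le_of_eq ?_)
    rw [intervalIntegral.integral_const_mul, increment]
    ring
  -- The remainder is `O(|h|^{2τ})` and `2τ > 1`.
  have hlim0 : Tendsto (fun h : ℝ => (h : ℂ)⁻¹ * R h) (𝓝[≠] 0) (𝓝 0) := by
    set A := ∑' n : ℤ, bracket n ^ (2 * τ) * ‖w n‖ ^ 2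
    have hA : Tendsto (fun h : ℝ => 8 * A * |h| ^ (2 * τ - 1)) (𝓝[≠] 0) (𝓝 0) := by
      have hc : ContinuousAt (fun h : ℝ => 8 * A * |h| ^ (2 * τ - 1)) 0 :=
        continuousAt_const.mul (continuous_abs.continuousAt.rpow_const (Or.inr (by linarith)))
      have := hc.tendsto
      rw [abs_zero, Real.zero_rpow (by linarith), mul_zero] at this
      exact this.mono_left nhdsWithin_le_nhds
    refine squeeze_zero_norm' ?_ hA
    filter_upwards [self_mem_nhdsWithin] with h hh
    have hh' : 0 < |h| := abs_pos.2 hh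
    have h2 := increment_fourierSeries_le hw (by linarith : (0 : ℝ) ≤ τ) h1 hs h
    rw [norm_mul, norm_inv, Complex.norm_real, Real.norm_eq_abs, inv_mul_le_iff₀ hh']
    have h3 : |h| ^ (2 * τ) = |h| * |h| ^ (2 * τ - 1) := by
      rw [← Real.rpow_one_add' hh'.le (by linarith)]
      congr 1
      ring
    calc ‖R h‖ ≤ 2 * increment W h := hRbound h
      _ ≤ 2 * (4 * |h| ^ (2 * τ) * A) := by gcongr
      _ = _ := by rw [h3]; ring
  -- The termwise limit, with `hconv` providing the dominating series.
  have hlim1 : Tendsto (fun h : ℝ => (h : ℂ)⁻¹ * R h) (𝓝[≠] 0)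
      (𝓝 (Complex.I * n * fourierInt F n +
        Complex.I * ∑' k : ℤ, fourierInt F (n - k) * (Complex.I * k * w k))) := by
    have hT : Tendsto (fun h : ℝ => ∑' k : ℤ,
        fourierInt F (n - k) * ((h : ℂ)⁻¹ * (expFun k h - 1) * w k)) (𝓝[≠] 0)
        (𝓝 (∑' k : ℤ, fourierInt F (n - k) * (Complex.I * k * w k))) := by
      refine tendsto_tsum_of_dominated_convergence hconv
        (fun k => ((tendsto_expFun_slope k).mul_const _).const_mul _)
        (Eventually.of_forall fun h k => ?_)
      rw [norm_mul, norm_mul, mul_comm]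
      gcongr
      exact norm_expFun_slope_le k h
    refine (((tendsto_expFun_slope n).mul_const (fourierInt F n)).add
      (hT.const_mul Complex.I)).congr fun h => ?_
    rw [hR]
    simp only
    rw [mul_add, mul_left_comm _ Complex.I, ← tsum_mul_left, ← tsum_mul_left,
      ← tsum_mul_left, mul_assoc]
    congr 1
    refine tsum_congr fun k => ?_
    ring
  have := tendsto_nhds_unique hlim1 hlim0
  have hI := Complex.I_mul_I
  linear_combination (-Complex.I) * this +
    (n * fourierInt F n + ∑' k : ℤ, fourierInt F (n - k) * (Complex.I * k * w k)) * hI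

end ChainRule

/-! ### Regularity of the gauge transform -/

section Gauge

theorem SobolevSummable.polyGrowth {s : ℝ} (hs : -1 ≤ s) {c : ℤ → ℂ} (hc : SobolevSummable s c) :
    PolyGrowth c := by
  set S := ∑' n : ℤ, bracket n ^ (2 * s) * ‖c n‖ ^ 2
  refine ⟨Real.sqrt S, 1, fun n => ?_⟩
  have hb := bracket_rpow_pos n
  have h1 : bracket n ^ (2 * s) * ‖c n‖ ^ 2 ≤ S :=
    hc.le_tsum n fun k _ => mul_nonneg (bracket_rpow_pos k _).le (sq_nonneg _)
  have h2 : bracket n ^ s * ‖c n‖ ≤ Real.sqrt S := by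
    refine Real.le_sqrt_of_sq_le (le_trans (le_of_eq ?_) h1)
    rw [mul_pow, ← Real.rpow_natCast, ← Real.rpow_mul (bracket_pos n).le]
    ring_nf
  have h3 : bracket n ^ (-s) ≤ 1 + |(n : ℝ)| := by
    calc bracket n ^ (-s) ≤ bracket n ^ (1 : ℝ) :=
          Real.rpow_le_rpow_of_exponent_le (one_le_bracket n) (by linarith)
      _ ≤ _ := by rw [Real.rpow_one]; exact bracket_le_one_add_abs n
  calc ‖c n‖ = bracket n ^ s * ‖c n‖ * bracket n ^ (-s) := by
        rw [Real.rpow_neg (bracket_pos n).le]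
        field_simp [(hb s).ne']
    _ ≤ Real.sqrt S * (1 + |(n : ℝ)|) := mul_le_mul h2 h3 (hb _).le (Real.sqrt_nonneg _)
    _ = _ := by rw [pow_one]

theorem summable_bracket_rpow {b : ℝ} (hb : 1 < b) : Summable fun n : ℤ => bracket n ^ (-b) := by
  refine (Real.summable_abs_int_rpow hb).of_norm_bounded_eventually ?_
  have : ∀ᶠ n : ℤ in Filter.cofinite, n ≠ 0 := (Set.finite_singleton (0 : ℤ)).compl_mem_cofinite
  filter_upwards [this] with n hn
  rw [Real.norm_of_nonneg (bracket_rpow_pos n _).le]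
  exact Real.rpow_le_rpow_of_nonpos (abs_pos.2 (by exact_mod_cast hn)) (abs_le_bracket n)
    (by linarith)

/-- Write `‖c‖ = (B ‖c‖) B⁻¹` with `B = ⟨n⟩^τ` and bound the product by the sum of squares; `∑
⟨n⟩^{-2τ}` converges as `2τ > 1`. -/
theorem SobolevSummable.summable_norm {τ : ℝ} (hτ : 1 / 2 < τ) {c : ℤ → ℂ}
    (hc : SobolevSummable τ c) : Summable fun n => ‖c n‖ := by
  refine Summable.of_nonneg_of_le (fun _ => norm_nonneg _) (fun n => ?_)
    (hc.add (summable_bracket_rpow (b := 2 * τ) (by linarith)))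
  have hp := bracket_rpow_pos n τ
  have e1 : bracket n ^ (2 * τ) = (bracket n ^ τ) ^ 2 := by
    rw [← Real.rpow_natCast, ← Real.rpow_mul (bracket_pos n).le, mul_comm]
    norm_num
  rw [Real.rpow_neg (bracket_pos n).le, e1]
  set B := bracket n ^ τ
  have e2 : ‖c n‖ = (B * ‖c n‖) * B⁻¹ := by field_simp
  rw [← inv_pow, ← mul_pow]
  nlinarith [sq_nonneg (B * ‖c n‖ - B⁻¹), sq_nonneg (B * ‖c n‖), sq_nonneg B⁻¹]

/-- The product of sequences in dual Sobolev classes has absolutely convergent convolution sums. -/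
theorem summable_convolution {ε : ℝ} (hε : 0 ≤ ε) {a b : ℤ → ℂ} (ha : SobolevSummable (-ε) a)
    (hb : SobolevSummable ε b) (n : ℤ) : Summable fun k => ‖a k‖ * ‖b (n - k)‖ := by
  have hb' : Summable fun k => bracket (n - k) ^ (2 * ε) * ‖b (n - k)‖ ^ 2 :=
    (Equiv.subLeft n).summable_iff.2 hb
  refine Summable.of_nonneg_of_le (fun _ => by positivity) (fun k => ?_)
    (ha.add (hb'.mul_left ((2 * bracket n) ^ (2 * ε))))
  have hk := bracket_pos k
  have hn := bracket_pos n
  have hnk := bracket_pos (n - k)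
  -- Peetre's inequality replaces the weight at `k` by the weight at `n - k`, at the price of a
  -- factor depending only on `n`.
  have e1 : bracket k ^ (2 * ε) ≤ (2 * bracket n) ^ (2 * ε) * bracket (n - k) ^ (2 * ε) := by
    rw [← Real.mul_rpow (by positivity) hnk.le]
    have := bracket_le_mul k n
    gcongr
  have e2 : bracket k ^ (2 * ε) = (bracket k ^ ε) ^ 2 := by
    rw [← Real.rpow_natCast, ← Real.rpow_mul hk.le, mul_comm]
    norm_num
  have hB : 0 < bracket k ^ ε := bracket_rpow_pos k ε
  have e3 : bracket k ^ (2 * -ε) = ((bracket k ^ ε) ^ 2)⁻¹ := by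
    rw [mul_neg, Real.rpow_neg hk.le, e2]
  rw [e3]
  calc ‖a k‖ * ‖b (n - k)‖
      ≤ ((bracket k ^ ε) ^ 2)⁻¹ * ‖a k‖ ^ 2 + (bracket k ^ ε) ^ 2 * ‖b (n - k)‖ ^ 2 := by
        set B := bracket k ^ ε
        have e4 : ‖a k‖ * ‖b (n - k)‖ = (B⁻¹ * ‖a k‖) * (B * ‖b (n - k)‖) := by field_simp
        rw [e4, ← inv_pow, ← mul_pow, ← mul_pow]
        nlinarith [sq_nonneg (B⁻¹ * ‖a k‖ - B * ‖b (n - k)‖), sq_nonneg (B⁻¹ * ‖a k‖),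
          sq_nonneg (B * ‖b (n - k)‖)]
    _ ≤ _ := by
        rw [← e2, ← mul_assoc]
        gcongr

theorem SobolevSummable.div_I_mul {s : ℝ} {c : ℤ → ℂ} (hc : SobolevSummable s c) :
    SobolevSummable (s + 1) fun n => if n = 0 then 0 else c n / (Complex.I * n) := by
  refine Summable.of_nonneg_of_le
    (fun n => mul_nonneg (bracket_rpow_pos n _).le (sq_nonneg _)) (fun n => ?_) (hc.mul_left 4)
  dsimp only
  split_ifs with hn
  · simpa using mul_nonneg (bracket_rpow_pos n _).le (sq_nonneg _)
  · have hn' : (0 : ℝ) < |(n : ℝ)| := abs_pos.2 (by exact_mod_cast hn)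
    have e : bracket n ^ (2 * (s + 1)) = bracket n ^ (2 * s) * bracket n ^ 2 := by
      rw [← Real.rpow_natCast, ← Real.rpow_add (bracket_pos n)]
      congr 1
      push_cast
      ring
    have h2 : bracket n ^ 2 ≤ 4 * |(n : ℝ)| ^ 2 := by
      have := bracket_le_two_mul_abs hn
      have := bracket_pos n
      calc bracket n ^ 2 ≤ (2 * |(n : ℝ)|) ^ 2 := by gcongr
        _ = _ := by ring
    rw [e, norm_div, norm_mul, Complex.norm_I, one_mul, Complex.norm_intCast, div_pow]
    have hb := bracket_rpow_pos n (2 * s)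
    calc bracket n ^ (2 * s) * bracket n ^ 2 * (‖c n‖ ^ 2 / |(n : ℝ)| ^ 2)
        ≤ bracket n ^ (2 * s) * (4 * |(n : ℝ)| ^ 2) * (‖c n‖ ^ 2 / |(n : ℝ)| ^ 2) := by gcongr
      _ = _ := by field_simp

/-- The antiderivative gains one derivative, the exponential loses `ε`, and the identity `F u = i
F'` loses one derivative. The bound `ε ≤ 1/4` gives `-1/2 < -ε`, `1/2 < 1 - ε` and `ε ≤ 1 - 2ε`, so
that the series and the dual pairing converge. -/
theorem gaugeTransform_regular {ε : ℝ} (h0 : 0 < ε) (h1 : ε ≤ 1 / 4) {u : Distribution}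
    (hu : MemSobolevZeroMeanReal (-ε) u) :
    GaugeDefined u ∧ MemSobolevZeroMean (-(2 * ε)) (gaugeTransform u) := by
  obtain ⟨⟨hsob, hmean⟩, hreal⟩ := hu
  set w : ℤ → ℂ := fun n => if n = 0 then 0 else u.coeff n / (Complex.I * n) with hwdef
  have hws : SobolevSummable (1 - ε) w := by
    have := SobolevSummable.div_I_mul (c := u.coeff) hsob
    rwa [neg_add_eq_sub] at this
  have hw : Summable fun n => ‖w n‖ := hws.summable_norm (by linarith)
  have hcoeff : (antideriv u).coeff = w :=
    funext fun n => coeff_ofCoeff (hws.polyGrowth (by linarith)) n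
  have hwreal : ∀ k, w k = (starRingEnd ℂ) (w (-k)) := by
    intro k
    by_cases hk : k = 0
    · simp [hwdef, hk]
    · simp only [hwdef, hk, neg_eq_zero, if_false, map_div₀, map_mul, ← hreal k, Complex.conj_I]
      simp
  have hexp : expAntideriv u = ofFunction (expSeries w) := by
    unfold expAntideriv expSeries fourierSeries Distribution.toFunction
    rw [hcoeff]
  have hF := expSeries_continuous hw
  have hFcoeff : (expAntideriv u).coeff = fourierInt (expSeries w) := by
    rw [hexp]
    exact funext fun n => coeff_ofFunction hF n
  have hFs : SobolevSummable (1 - 2 * ε) (fourierInt (expSeries w)) := by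
    refine sobolevSummable_of_increment_le hF (expSeries_periodic w) (τ := 1 - ε)
      (A := 4 * ∑' n : ℤ, bracket n ^ (2 * (1 - ε)) * ‖w n‖ ^ 2) (by linarith) (by linarith)
      fun h => ?_
    refine (increment_le_of_norm_sub_le hF (fourierSeries_continuous hw)
      (norm_expSeries_sub_le hwreal) h).trans ?_
    refine (increment_fourierSeries_le hw (by linarith) (by linarith) hws h).trans (le_of_eq ?_)
    ring
  have hFmem : MemSobolev (1 - 2 * ε) (expAntideriv u) := by
    unfold MemSobolev
    rw [hFcoeff]
    exact hFs
  have hFε : MemSobolev ε (expAntideriv u) := hFmem.mono (by linarith)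
  have huw : ∀ k : ℤ, Complex.I * k * w k = u.coeff k := by
    intro k
    by_cases hk : k = 0
    · simp [hwdef, hk, hmean]
    · have : (k : ℂ) ≠ 0 := by exact_mod_cast hk
      simp only [hwdef, hk, if_false]
      field_simp
  have hprod : ∀ n : ℤ, ∑' m : ℤ, (expAntideriv u).coeff m * u.coeff (n - m) =
      -n * fourierInt (expSeries w) n := by
    intro n
    -- The convolution is reindexed by `m ↦ n - m` to match the chain rule, whose summability
    -- hypothesis is the duality of `H^{-ε}` and `H^ε`.
    rw [← tsum_fourierInt_expSeries hw hwreal (by linarith : 1 / 2 < 1 - ε) (by linarith) hws n,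
      ← (Equiv.subLeft n).tsum_eq]
    · simp only [Equiv.subLeft_apply, sub_sub_cancel, huw, hFcoeff]
    · refine (summable_convolution h0.le (a := u.coeff) (b := fourierInt (expSeries w)) hsob
        (by rw [← hFcoeff]; exact hFε) n).congr fun k => ?_
      rw [← huw, norm_mul, norm_mul, Complex.norm_I, one_mul, Complex.norm_intCast]
  have hFle : ∀ n, ‖fourierInt (expSeries w) n‖ ≤ 1 :=
    norm_fourierInt_le fun x => (norm_expSeries hwreal x).le
  -- `ofCoeff` returns the zero distribution without polynomial growth, so this bound is needed
  -- before any coefficient of the product can be read off.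
  have hgrow : ∀ n : ℤ, ‖-(n : ℂ) * fourierInt (expSeries w) n‖ ≤ 1 * (1 + |(n : ℝ)|) ^ 1 := by
    intro n
    rw [norm_mul, norm_neg, Complex.norm_intCast]
    nlinarith [hFle n, abs_nonneg (n : ℝ), norm_nonneg (fourierInt (expSeries w) n)]
  have hmul : ∀ n, (mul (expAntideriv u) u).coeff n = -n * fourierInt (expSeries w) n := by
    intro n
    unfold mul
    simp_rw [hprod]
    exact coeff_ofCoeff ⟨1, 1, hgrow⟩ n
  have hgauge : ∀ n, (gaugeTransform u).coeff n =
      if 0 < n then -n * fourierInt (expSeries w) n else 0 := by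
    intro n
    unfold gaugeTransform posProj
    simp_rw [hmul]
    refine coeff_ofCoeff ⟨1, 1, fun k => ?_⟩ n
    split_ifs
    · exact hgrow k
    · rw [norm_zero]
      positivity
  refine ⟨⟨-ε, by linarith, by linarith, ⟨⟨hsob, hmean⟩, hreal⟩, ?_, ?_⟩, ?_, ?_⟩
  · rw [hcoeff]
    exact hw
  · rwa [neg_neg]
  · refine Summable.of_nonneg_of_le
      (fun n => mul_nonneg (bracket_rpow_pos n _).le (sq_nonneg _)) (fun n => ?_) hFs
    rw [hgauge]
    split_ifs with hn
    · have e : bracket n ^ (2 * (1 - 2 * ε)) = bracket n ^ (2 * -(2 * ε)) * bracket n ^ 2 := by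
        rw [← Real.rpow_natCast, ← Real.rpow_add (bracket_pos n)]
        congr 1
        push_cast
        ring
      rw [e, norm_mul, norm_neg, Complex.norm_intCast, mul_pow, mul_assoc]
      have := abs_le_bracket n
      have := bracket_rpow_pos n (2 * -(2 * ε))
      gcongr
    · simpa using mul_nonneg (bracket_rpow_pos n _).le (sq_nonneg _)
  · simp [hgauge]

end Gauge

/-! ### Almost sure regularity of the random series -/

section Probability

variable {Ω : Type*}

theorem norm_phiCoeff_sq (h l : ℕ+ → Ω → ℝ) (ω : Ω) (n : ℤ) :
    ‖phiCoeff h l ω n‖ ^ 2 = (8 * Real.pi * |(n : ℝ)|)⁻¹ *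
      (h n.natAbs.toPNat' ω ^ 2 + l n.natAbs.toPNat' ω ^ 2) := by
  rcases eq_or_ne n 0 with rfl | hn
  -- At `n = 0` the right side vanishes too, by the convention `0⁻¹ = 0`.
  · simp [phiCoeff]
  have hg : ‖gaussCoeff h l ω n‖ ^ 2 =
      (h n.natAbs.toPNat' ω ^ 2 + l n.natAbs.toPNat' ω ^ 2) / 2 := by
    unfold gaussCoeff
    rcases hn.lt_or_gt with h' | h'
    · simp only [h', h'.not_gt, if_true, if_false]
      rw [norm_div, div_pow, Complex.norm_real, Real.norm_eq_abs, sq_abs,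
        Real.sq_sqrt zero_le_two, Complex.sq_norm, Complex.normSq_apply]
      simp
      ring
    · simp only [h', if_true]
      rw [norm_div, div_pow, Complex.norm_real, Real.norm_eq_abs, sq_abs,
        Real.sq_sqrt zero_le_two, Complex.sq_norm, Complex.normSq_apply]
      simp
      ring
  rw [phiCoeff, if_neg hn, norm_div, div_pow, hg, Complex.norm_real, Real.norm_eq_abs, sq_abs,
    mul_pow, Real.sq_sqrt (by positivity)]
  have := Real.pi_pos
  have : (0 : ℝ) < |(n : ℝ)| := abs_pos.2 (by exact_mod_cast hn)
  field_simp
  norm_num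

theorem phiCoeff_eq_conj_neg (h l : ℕ+ → Ω → ℝ) (ω : Ω) (n : ℤ) :
    phiCoeff h l ω n = (starRingEnd ℂ) (phiCoeff h l ω (-n)) := by
  rcases lt_trichotomy n 0 with hn | rfl | hn
  · simp [phiCoeff, gaussCoeff, hn, hn.ne, hn.not_gt, Complex.conj_ofNat]
  · simp [phiCoeff]
  · simp [phiCoeff, gaussCoeff, hn, hn.ne', hn.not_gt, sub_eq_add_neg, Complex.conj_ofNat]

variable [MeasurableSpace Ω] {p : Measure Ω}

/-- By Tonelli the sum has expectation at most `B ∑ c n`, so it is almost surely finite. -/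
theorem ae_summable_of_integral_le {c : ℤ → ℝ} (hc0 : ∀ n, 0 ≤ c n) (hc : Summable c)
    {X : ℤ → Ω → ℝ} (hX0 : ∀ n ω, 0 ≤ X n ω) (hX : ∀ n, Integrable (X n) p) {B : ℝ}
    (hB : ∀ n, ∫ ω, X n ω ∂p ≤ B) : ∀ᵐ ω ∂p, Summable fun n => c n * X n ω := by
  have hmeas : ∀ n, AEMeasurable (fun ω => ENNReal.ofReal (c n * X n ω)) p :=
    fun n => ((hX n).aemeasurable.const_mul _).ennreal_ofReal
  have hfin : ∫⁻ ω, ∑' n, ENNReal.ofReal (c n * X n ω) ∂p ≠ ⊤ := by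
    rw [lintegral_tsum hmeas]
    refine ne_top_of_le_ne_top (hc.mul_right B).tsum_ofReal_ne_top (ENNReal.tsum_le_tsum fun n => ?_)
    rw [← ofReal_integral_eq_lintegral_ofReal ((hX n).const_mul _)
      (Filter.Eventually.of_forall fun ω => mul_nonneg (hc0 n) (hX0 n ω)), integral_const_mul]
    exact ENNReal.ofReal_le_ofReal (mul_le_mul_of_nonneg_left (hB n) (hc0 n))
  filter_upwards [ae_lt_top' (AEMeasurable.tsum hmeas) hfin] with ω hω
  refine (ENNReal.summable_toReal hω.ne).congr fun n => ?_
  rw [ENNReal.toReal_ofReal (mul_nonneg (hc0 n) (hX0 n ω))]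

theorem integrable_sq_of_map_eq_gaussianReal {X : Ω → ℝ} (hX : Measurable X)
    (hlaw : p.map X = gaussianReal 0 1) :
    Integrable (fun ω => X ω ^ 2) p ∧ ∫ ω, X ω ^ 2 ∂p = 1 := by
  have hint : Integrable (fun x : ℝ => x ^ 2) (gaussianReal 0 1) :=
    (memLp_id_gaussianReal (μ := 0) (v := 1) 2).integrable_sq
  constructor
  · rw [← hlaw] at hint
    exact hint.comp_measurable hX
  · have hv := variance_id_gaussianReal (μ := 0) (v := 1)
    rw [variance_of_integral_eq_zero aemeasurable_id (by simp)] at hv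
    rw [← integral_map (f := fun x : ℝ => x ^ 2) hX.aemeasurable
      (by fun_prop), hlaw]
    simpa using hv

theorem ae_sobolevSummable_phiCoeff [IsProbabilityMeasure p] {h l : ℕ+ → Ω → ℝ}
    (h_meas : ∀ n, Measurable (h n)) (l_meas : ∀ n, Measurable (l n))
    (h_law : ∀ n, p.map (h n) = gaussianReal 0 1) (l_law : ∀ n, p.map (l n) = gaussianReal 0 1)
    {ε : ℝ} (hε : 0 < ε) : ∀ᵐ ω ∂p, SobolevSummable (-ε) (phiCoeff h l ω) := by
  -- Comparison with `∑ |n|^{-1-2ε}`.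
  have hc : Summable fun n : ℤ => bracket n ^ (2 * -ε) * (8 * Real.pi * |(n : ℝ)|)⁻¹ := by
    refine Summable.of_nonneg_of_le
      (fun n => mul_nonneg (bracket_rpow_pos n _).le (by positivity)) (fun n => ?_)
      (Real.summable_abs_int_rpow (b := 1 + 2 * ε) (by linarith))
    rcases eq_or_ne n 0 with rfl | hn
    · simp
      positivity
    have hn' : (0 : ℝ) < |(n : ℝ)| := abs_pos.2 (by exact_mod_cast hn)
    rw [neg_add, Real.rpow_add hn', Real.rpow_neg_one, mul_comm]
    have h1 : bracket n ^ (2 * -ε) ≤ |(n : ℝ)| ^ (-(2 * ε)) := by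
      rw [mul_neg]
      exact Real.rpow_le_rpow_of_nonpos hn' (abs_le_bracket n) (by linarith)
    have h2 : (8 * Real.pi * |(n : ℝ)|)⁻¹ ≤ |(n : ℝ)|⁻¹ := by
      have := Real.pi_gt_three
      gcongr
      nlinarith
    have := bracket_rpow_pos n (2 * -ε)
    gcongr
  have hh := fun n => integrable_sq_of_map_eq_gaussianReal (h_meas n) (h_law n)
  have hl := fun n => integrable_sq_of_map_eq_gaussianReal (l_meas n) (l_law n)
  filter_upwards [ae_summable_of_integral_le (p := p) (B := 2)
    (fun n => mul_nonneg (bracket_rpow_pos n _).le (by positivity)) hc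
    (X := fun n ω => h n.natAbs.toPNat' ω ^ 2 + l n.natAbs.toPNat' ω ^ 2)
    (fun n ω => by positivity) (fun n => (hh _).1.add (hl _).1)
    (fun n => by
      rw [integral_add (hh _).1 (hl _).1, (hh _).2, (hl _).2]
      norm_num)] with ω hω
  refine hω.congr fun n => ?_
  rw [norm_phiCoeff_sq, mul_assoc]

end Probability
end BenjaminOno

/-! ### The main theorem -/

theorem mainTheorem4 {Ω : Type*} [MeasurableSpace Ω] (p : Measure Ω) [IsProbabilityMeasure p]
    (h l : ℕ+ → Ω → ℝ)
    (h_meas : ∀ n, Measurable (h n)) (l_meas : ∀ n, Measurable (l n))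
    (h_law : ∀ n, p.map (h n) = gaussianReal 0 1) (l_law : ∀ n, p.map (l n) = gaussianReal 0 1)
    (indep : iIndepFun (Sum.elim h l) p)
    (s : ℝ) (hs : s < 0) :
    ∀ᵐ ω ∂p,
      (∀ n : ℤ, (BenjaminOno.phi h l ω).coeff n = BenjaminOno.phiCoeff h l ω n) ∧
      BenjaminOno.GaugeDefined (BenjaminOno.phi h l ω) ∧
      BenjaminOno.MemSobolevZeroMean s
        (BenjaminOno.gaugeTransform (BenjaminOno.phi h l ω)) := by
  -- The bound `-s/2` yields `s ≤ -2ε`, hence `H^{-2ε} ⊆ H^s`; the bound `1/4` is what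
  -- `gaugeTransform_regular` requires.
  open BenjaminOno in
  set ε := min (1 / 4) (-s / 2)
  have hε0 : 0 < ε := lt_min (by norm_num) (by linarith)
  have hε1 : ε ≤ 1 / 4 := min_le_left _ _
  have hε2 : ε ≤ -s / 2 := min_le_right _ _
  filter_upwards [ae_sobolevSummable_phiCoeff h_meas l_meas h_law l_law hε0] with ω hω
  have hcoeff : (phi h l ω).coeff = phiCoeff h l ω :=
    funext fun n => coeff_ofCoeff (hω.polyGrowth (by linarith)) n
  have hu : MemSobolevZeroMeanReal (-ε) (phi h l ω) := by
    refine ⟨⟨?_, ?_⟩, fun n => ?_⟩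
    · unfold MemSobolev
      rw [hcoeff]
      exact hω
    · simp [hcoeff, phiCoeff]
    · rw [hcoeff]
      exact phiCoeff_eq_conj_neg h l ω n
  obtain ⟨hdef, hreg, hmean⟩ := gaugeTransform_regular hε0 hε1 hu
  exact ⟨fun n => congrFun hcoeff n, hdef, hreg.mono (by linarith), hmean⟩
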